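/- Let $Z$ be a non-empty set of states, $F$ a correspondence assigning to each $z\in Z$ a non-empty subset $F(z)\subseteq Z$, and $r:Z\to[0,1]$ a reward mapping (a deterministic dynamic programming problem). For $z_0\in Z$ let $S(z_0)=\{(z_t)_{t\ge1}\in Z^{\infty}:\ z_t\in F(z_{t-1})\ \forall t\ge 1\}$ be the set of plays at $z_0$. An evaluation is a probability $\theta=(\theta_t)_{t\ge1}$ on the positive integers; $\Theta$ is the set of evaluations, $TV(\theta)=\sum_{t\ge1}|\theta_{t+1}-\theta_t|$, and for $m\ge 0$, $\theta\oplus m=\sum_{t\ge1}\theta_t\delta_{m+t}$ is the shifted evaluation. The $\theta$-value is $$v_\theta(z)=\sup_{(z_t)\in S(z)}\ \sum_{t=1}^\infty\theta_t\, r(z_t),$$ $v_{m,\theta}:=v_{\theta\oplus m}$, and $$v^*(z)=\inf_{\theta\in\Theta}\ \sup_{m\ge0}\ v_{m,\theta}(z).$$ Let $\mathcal V$ be the set of functions from $Z$ to $[0,1]$ with the supremum metric; convergence, total boundedness and compactness below refer to $\mathcal V$. Let $(\theta^k)_k$ be a sequence of evaluations with $TV(\theta^k)\to0$ as $k\to\infty$.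 Then: 1) If $(v_{\theta^k})_k$ converges, its limit is $v^*$. 2) $(v_{\theta^k})_k$ converges if and only if the set $\{v_{\theta^k}: k\}$ is totally bounded, and also if and only if the set $\{v_{\theta^k}: k\}\cup\{v^*\}$ is compact. Moreover (independently of the sequence): 3) If $Z$ is endowed with a distance $d$ such that $(Z,d)$ is a totally bounded metric space and the family $(v_\theta)_{\theta\in\Theta}$ is uniformly equicontinuous, then there is general uniform convergence of the value functions to $v^*$: $$\forall\varepsilon>0\ \exists\alpha>0\ \forall\theta\in\Theta\ \text{with}\ TV(\theta)\le\alpha:\quad \sup_{z\in Z}|v_\theta(z)-v^*(z)|\le\varepsilon .$$ 4) The same conclusion holds if $Z$ is endowed with a distance $d$ such that $(Z,d)$ is a precompact (i.e. totally bounded) metric space, $r$ is uniformly continuous, and $F$ is non-expansive: for all $z,z'\in Z$ and all $z_1\in F(z)$ there is $z_1'\in F(z')$ with $d(z_1,z_1')\le d(z,z')$. -/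

import Mathlib

open Filter Topology
open scoped UniformConvergence

noncomputable section

/-- A (deterministic) dynamic programming problem with set of states `Z`: a transition
correspondence `F` with nonempty values and a reward mapping `r` from `Z` to `[0,1]`. -/
structure DynProg (Z : Type*) where
  F : Z → Set Z
  F_nonempty : ∀ z, (F z).Nonempty
  r : Z → unitInterval

/-- An evaluation `(θ_t)_{t ≥ 1}` is a probability on the positive integers. -/
abbrev Evaluation := PMF ℕ+

namespace Evaluation

/-- The real number `θ_t`. -/
def weight (θ : Evaluation) (t : ℕ+) : ℝ := (θ t).toReal

/-- The total variation `TV(θ) = ∑_{t ≥ 1} |θ_{t+1} - θ_t|`. -/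
def TV (θ : Evaluation) : ℝ := ∑' t : ℕ+, |weight θ (t + 1) - weight θ t|

/-- The stage `m + t`, for `m ≥ 0` and `t ≥ 1`. -/
def shiftStage (m : ℕ) (t : ℕ+) : ℕ+ := ⟨m + (t : ℕ), Nat.add_pos_right m t.pos⟩

/-- The shifted evaluation `θ ⊕ m = ∑_{t ≥ 1} θ_t δ_{m+t}`. -/
def shift (θ : Evaluation) (m : ℕ) : Evaluation :=
  PMF.map (shiftStage m) θ

theorem weight_nonneg (θ : Evaluation) (t : ℕ+) : 0 ≤ weight θ t := ENNReal.toReal_nonneg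

theorem hasSum_weight (θ : Evaluation) : HasSum (weight θ) 1 := by
  have h : HasSum (fun t => (θ t).toReal) (∑' t, (θ t).toReal) :=
    ENNReal.hasSum_toReal (by simp [θ.tsum_coe])
  rw [← ENNReal.tsum_toReal_eq θ.apply_ne_top, θ.tsum_coe, ENNReal.toReal_one] at h
  exact h

end Evaluation

namespace DynProg

variable {Z : Type*}

/-- The plays at `z`: sequences `z_0 = z, z_1, z_2, …` with `z_{t+1} ∈ F (z_t)` for all `t ≥ 0`.
(The initial state is kept as the term of index `0`.) -/
def plays (Γ : DynProg Z) (z : Z) : Set (ℕ → Z) :=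
  {s | s 0 = z ∧ ∀ t, s (t + 1) ∈ Γ.F (s t)}

/-- The `θ`-payoff `γ_θ(s) = ∑_{t ≥ 1} θ_t r(z_t)`. -/
def payoff (Γ : DynProg Z) (θ : Evaluation) (s : ℕ → Z) : ℝ :=
  ∑' t : ℕ+, Evaluation.weight θ t * (Γ.r (s t) : ℝ)

/-- The `θ`-value `v_θ(z)`. -/
def value (Γ : DynProg Z) (θ : Evaluation) (z : Z) : ℝ :=
  ⨆ s : Γ.plays z, Γ.payoff θ s

/-- `v*(z) = inf_θ sup_{m ≥ 0} v_{m,θ}(z)`, with `v_{m,θ}` the value function of `θ ⊕ m`. -/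
def valueStar (Γ : DynProg Z) (z : Z) : ℝ :=
  ⨅ θ : Evaluation, ⨆ m : ℕ, Γ.value (Evaluation.shift θ m) z

theorem plays_nonempty (Γ : DynProg Z) (z : Z) : (Γ.plays z).Nonempty :=
  ⟨fun t => Nat.rec z (fun _ y => (Γ.F_nonempty y).some) t, rfl,
    fun _ => (Γ.F_nonempty _).some_mem⟩

theorem summable_payoff (Γ : DynProg Z) (θ : Evaluation) (s : ℕ → Z) :
    Summable fun t : ℕ+ => Evaluation.weight θ t * (Γ.r (s t) : ℝ) :=
  Summable.of_nonneg_of_le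
    (fun t => mul_nonneg (Evaluation.weight_nonneg θ t) (Γ.r (s t)).2.1)
    (fun t => mul_le_of_le_one_right (Evaluation.weight_nonneg θ t) (Γ.r (s t)).2.2)
    (Evaluation.hasSum_weight θ).summable

theorem payoff_mem (Γ : DynProg Z) (θ : Evaluation) (s : ℕ → Z) :
    Γ.payoff θ s ∈ Set.Icc (0 : ℝ) 1 := by
  refine ⟨tsum_nonneg fun t =>
    mul_nonneg (Evaluation.weight_nonneg θ t) (Γ.r (s t)).2.1, ?_⟩
  rw [← (Evaluation.hasSum_weight θ).tsum_eq]
  exact (Γ.summable_payoff θ s).tsum_le_tsum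
    (fun t => mul_le_of_le_one_right (Evaluation.weight_nonneg θ t) (Γ.r (s t)).2.2)
    (Evaluation.hasSum_weight θ).summable

theorem value_mem (Γ : DynProg Z) (θ : Evaluation) (z : Z) :
    Γ.value θ z ∈ Set.Icc (0 : ℝ) 1 :=
  ⟨Real.iSup_nonneg fun s => (Γ.payoff_mem θ s).1,
    Real.iSup_le (fun s => (Γ.payoff_mem θ s).2) zero_le_one⟩

theorem valueStar_mem (Γ : DynProg Z) (z : Z) : Γ.valueStar z ∈ Set.Icc (0 : ℝ) 1 := by
  have h0 : ∀ θ : Evaluation, 0 ≤ ⨆ m : ℕ, Γ.value (Evaluation.shift θ m) z :=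
    fun θ => Real.iSup_nonneg fun m => (Γ.value_mem _ z).1
  refine ⟨Real.iInf_nonneg h0, ?_⟩
  refine (ciInf_le ⟨0, ?_⟩ (PMF.pure (1 : ℕ+))).trans
    (Real.iSup_le (fun m => (Γ.value_mem _ z).2) zero_le_one)
  rintro _ ⟨θ, rfl⟩
  exact h0 θ

/-- `v_θ` as a point of the space of functions from `Z` to `[0,1]`, which carries the topology
and the uniformity of uniform convergence, i.e. those of the supremum metric. -/
def valueFun (Γ : DynProg Z) (θ : Evaluation) : Z →ᵤ unitInterval :=
  UniformFun.ofFun fun z => ⟨Γ.value θ z, Γ.value_mem θ z⟩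

/-- `v*` as a point of the space of functions from `Z` to `[0,1]` with the supremum metric. -/
def valueStarFun (Γ : DynProg Z) : Z →ᵤ unitInterval :=
  UniformFun.ofFun fun z => ⟨Γ.valueStar z, Γ.valueStar_mem z⟩

/-- Non expansive transitions. -/
def NonExpansive [MetricSpace Z] (Γ : DynProg Z) : Prop :=
  ∀ z z' : Z, ∀ z₁ ∈ Γ.F z, ∃ z₁' ∈ Γ.F z', dist z₁ z₁' ≤ dist z z'

/-- General uniform convergence of the value functions to `v*`. -/
def GeneralUniformConvergence (Γ : DynProg Z) : Prop :=
  ∀ ε > (0 : ℝ), ∃ α > (0 : ℝ), ∀ θ : Evaluation, Evaluation.TV θ ≤ α →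
    ∀ z, |Γ.value θ z - Γ.valueStar z| ≤ ε

end DynProg

end

/-!
The argument compares an evaluation `θ` of small total variation with averages of shifted
evaluations, and has two halves.

*Upper bound.* Shifting the rewards along a play by one stage changes its `θ`-payoff by at most
`2 TV(θ)`. Hence, if `η` is a fixed evaluation and `TV(θ)` is small, the `θ`-payoff of a play is
close to the payoff for the convolution of `θ` and `η`, which is also the `θ`-average over `m` of
the `η ⊕ m`-payoffs. So `v_θ ≤ sup_m v_{m,η} + C(η, TV(θ))` with `C(η, x) → 0` as `x → 0`
(`DynProg.value_le_iSup_add`), and every pointwise limit of values is at most `v*`.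

*Lower bound.* Let `w` be a uniform limit of values `v_θ` with `TV(θ) → 0`. The one-stage estimate
shows that `w` does not increase along plays, and `v_{m,θ}(z)` is at most the supremum of `v_θ`
over the states reachable from `z` in `m` stages. Therefore
`v*(z) ≤ sup_m v_{m,θ}(z) ≤ w(z) + ε` (`DynProg.valueStar_le_of_tendstoUniformly`).

Both halves hold along any nontrivial filter, in particular along ultrafilters. As the space of
functions with the uniform metric is complete, convergence to `v*` along a filter follows once the
values are Cauchy along every finer ultrafilter (`DynProg.tendsto_valueStarFun_of_cauchy`). Total
boundedness gives this for sequences; equicontinuity over a totally bounded state space gives it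
along the filter of all evaluations whose total variation tends to zero. For non expansive
transitions, equicontinuity comes from following a play at `z` by a play at `z'` that stays within
distance `d(z, z')` of it.
-/

/-! ### Shifted evaluations and total variation -/

namespace Evaluation

theorem TV_nonneg (θ : Evaluation) : 0 ≤ TV θ := tsum_nonneg fun _ => abs_nonneg _

theorem shiftStage_injective (m : ℕ) : Function.Injective (shiftStage m) := by
  intro a b h
  have h' := congrArg (fun t : ℕ+ => (t : ℕ)) h
  simp only [shiftStage, PNat.mk_coe] at h'
  exact PNat.eq (by omega)

theorem weight_shift_shiftStage (θ : Evaluation) (m : ℕ) (t : ℕ+) :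
    weight (shift θ m) (shiftStage m t) = weight θ t := by
  classical
  unfold weight shift
  rw [PMF.map_apply, tsum_eq_single t]
  · simp
  · intro b hb
    rw [if_neg fun h => hb (shiftStage_injective m h).symm]

theorem weight_shift_of_notMem_range (θ : Evaluation) (m : ℕ) {t : ℕ+}
    (ht : t ∉ Set.range (shiftStage m)) : weight (shift θ m) t = 0 := by
  classical
  unfold weight shift
  rw [PMF.map_apply, ENNReal.tsum_eq_zero.2]
  · simp
  · intro b
    rw [if_neg fun h => ht ⟨b, h.symm⟩]

theorem summable_weight_mul (θ : Evaluation) {a : ℕ+ → ℝ} (h0 : ∀ t, 0 ≤ a t)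
    (h1 : ∀ t, a t ≤ 1) : Summable fun t => weight θ t * a t :=
  (hasSum_weight θ).summable.of_nonneg_of_le (fun t => mul_nonneg (weight_nonneg θ t) (h0 t))
    fun t => mul_le_of_le_one_right (weight_nonneg θ t) (h1 t)

theorem tsum_weight_mul_le (θ : Evaluation) {a : ℕ+ → ℝ} {c : ℝ} (h0 : ∀ t, 0 ≤ a t)
    (h1 : ∀ t, a t ≤ 1) (hc : ∀ t, a t ≤ c) : ∑' t, weight θ t * a t ≤ c := by
  have h := (hasSum_weight θ).mul_right c
  rw [one_mul] at h
  rw [← h.tsum_eq]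
  exact (summable_weight_mul θ h0 h1).tsum_le_tsum
    (fun t => mul_le_mul_of_nonneg_left (hc t) (weight_nonneg θ t)) h.summable

theorem summable_weight_add_one (θ : Evaluation) : Summable fun t : ℕ+ => weight θ (t + 1) :=
  (hasSum_weight θ).summable.comp_injective (add_left_injective 1)

theorem tsum_eq_apply_one_add {f : ℕ+ → ℝ} (hf : Summable f) :
    ∑' t, f t = f 1 + ∑' t : ℕ+, f (t + 1) := by
  have e := Equiv.pnatEquivNat.symm.tsum_eq f
  have e' := Equiv.pnatEquivNat.symm.tsum_eq fun t : ℕ+ => f (t + 1)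
  rw [← e, ← e']
  exact (Equiv.pnatEquivNat.symm.summable_iff.2 hf).tsum_eq_zero_add

theorem summable_abs_sub (θ : Evaluation) :
    Summable fun t : ℕ+ => |weight θ (t + 1) - weight θ t| :=
  ((summable_weight_add_one θ).sub (hasSum_weight θ).summable).abs

theorem weight_one_le_TV (θ : Evaluation) : weight θ 1 ≤ TV θ := by
  have hs := (hasSum_weight θ).summable
  have h := tsum_eq_apply_one_add hs
  have h' := hs.tsum_sub (summable_weight_add_one θ)
  have : ∑' t : ℕ+, (weight θ t - weight θ (t + 1)) ≤ TV θ :=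
    (hs.sub (summable_weight_add_one θ)).tsum_le_tsum
      (fun t => (le_abs_self _).trans_eq (abs_sub_comm _ _)) (summable_abs_sub θ)
  linarith

/-- Moving the arguments of a `[0,1]`-valued function by one stage changes its mean for `θ` by at
most `2 TV(θ)`: by summation by parts, the change is
`∑ (θ_t - θ_{t+1}) a_{t+1} - θ_1 a_1`. -/
theorem abs_tsum_succ_sub_le (θ : Evaluation) {a : ℕ+ → ℝ} (h0 : ∀ t, 0 ≤ a t)
    (h1 : ∀ t, a t ≤ 1) :
    |∑' t, weight θ t * a (t + 1) - ∑' t, weight θ t * a t| ≤ 2 * TV θ := by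
  have hs := summable_weight_mul θ h0 h1
  have hs1 := summable_weight_mul θ (fun t => h0 (t + 1)) (fun t => h1 (t + 1))
  have hs2 : Summable fun t : ℕ+ => weight θ (t + 1) * a (t + 1) :=
    hs.comp_injective (add_left_injective (1 : ℕ+))
  rw [tsum_eq_apply_one_add hs]
  have hd := hs2.tsum_sub hs1
  have hle : ‖∑' t : ℕ+, (weight θ (t + 1) * a (t + 1) - weight θ t * a (t + 1))‖ ≤ TV θ := by
    refine tsum_of_norm_bounded (summable_abs_sub θ).hasSum fun t => ?_
    rw [← sub_mul, Real.norm_eq_abs, abs_mul, abs_of_nonneg (h0 _)]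
    exact mul_le_of_le_one_right (abs_nonneg _) (h1 _)
  rw [hd, Real.norm_eq_abs, abs_le] at hle
  have hw := weight_one_le_TV θ
  have ha0 := mul_nonneg (weight_nonneg θ 1) (h0 1)
  have ha1 := mul_le_of_le_one_right (weight_nonneg θ 1) (h1 1)
  rw [abs_le]
  constructor <;> linarith [hle.1, hle.2]

/-- A bound for the change of a payoff when an evaluation of total variation `x` is replaced by
its convolution with `η`: a shift by `t` stages costs at most `min 1 (2 t x)`. -/
noncomputable def smoothingError (η : Evaluation) (x : ℝ) : ℝ :=
  ∑' t : ℕ+, weight η t * min 1 (2 * ((t : ℕ) : ℝ) * x)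

/-- Dominated convergence: the cap at `1` makes the weights of `η` a summable bound, although the
mean of `η` may be infinite. -/
theorem tendsto_smoothingError (η : Evaluation) {ι : Type*} {l : Filter ι} {x : ι → ℝ}
    (hx0 : ∀ i, 0 ≤ x i) (hx : Tendsto x l (𝓝 0)) :
    Tendsto (fun i => smoothingError η (x i)) l (𝓝 0) := by
  have h : Tendsto (fun i => smoothingError η (x i)) l (𝓝 (∑' _ : ℕ+, (0 : ℝ))) := by
    refine tendsto_tsum_of_dominated_convergence (hasSum_weight η).summable (fun t => ?_)
      (Eventually.of_forall fun i t => ?_)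
    · have h1 : Tendsto (fun i => weight η t * min 1 (2 * ((t : ℕ) : ℝ) * x i)) l
          (𝓝 (weight η t * min 1 (2 * ((t : ℕ) : ℝ) * 0))) :=
        (tendsto_const_nhds.min (hx.const_mul _)).const_mul _
      simpa using h1
    · have hm : 0 ≤ min 1 (2 * ((t : ℕ) : ℝ) * x i) :=
        le_min zero_le_one (mul_nonneg (by positivity) (hx0 i))
      rw [Real.norm_eq_abs, abs_of_nonneg (mul_nonneg (weight_nonneg η t) hm)]
      exact mul_le_of_le_one_right (weight_nonneg η t) (min_le_left _ _)
  simpa using h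

end Evaluation

namespace DynProg

variable {Z : Type*}

/-! ### Payoffs along shifted plays -/

theorem payoff_shift (Γ : DynProg Z) (θ : Evaluation) (m : ℕ) (s : ℕ → Z) :
    Γ.payoff (Evaluation.shift θ m) s = Γ.payoff θ fun t => s (m + t) := by
  unfold payoff
  rw [← (Evaluation.shiftStage_injective m).tsum_eq]
  · exact tsum_congr fun t => by rw [Evaluation.weight_shift_shiftStage]; rfl
  · intro t ht
    by_contra h
    exact ht (by simp [Evaluation.weight_shift_of_notMem_range θ m h])

theorem abs_payoff_drop_one_sub_le (Γ : DynProg Z) (θ : Evaluation) (s : ℕ → Z) :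
    |Γ.payoff θ (fun t => s (t + 1)) - Γ.payoff θ s| ≤ 2 * Evaluation.TV θ :=
  Evaluation.abs_tsum_succ_sub_le θ (a := fun t : ℕ+ => (Γ.r (s t) : ℝ))
    (fun _ => (Γ.r _).2.1) fun _ => (Γ.r _).2.2

theorem payoff_le_payoff_drop_add (Γ : DynProg Z) (θ : Evaluation) (s : ℕ → Z) (m : ℕ) :
    Γ.payoff θ s ≤ Γ.payoff θ (fun t => s (m + t)) + 2 * m * Evaluation.TV θ := by
  induction m with
  | zero => simp
  | succ m ih =>
    have h := (abs_le.1 (Γ.abs_payoff_drop_one_sub_le θ fun t => s (m + t))).1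
    have e : (fun t => s (m + 1 + t)) = fun t => s (m + (t + 1)) := by
      funext t; congr 1; omega
    rw [e]
    push_cast
    linarith

theorem payoff_le_value (Γ : DynProg Z) (θ : Evaluation) {z : Z} {s : ℕ → Z}
    (hs : s ∈ Γ.plays z) : Γ.payoff θ s ≤ Γ.value θ z :=
  le_ciSup (f := fun s : Γ.plays z => Γ.payoff θ s)
    ⟨1, by rintro _ ⟨s, rfl⟩; exact (Γ.payoff_mem θ s).2⟩ ⟨s, hs⟩

theorem value_le (Γ : DynProg Z) (θ : Evaluation) {z : Z} {c : ℝ}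
    (h : ∀ s ∈ Γ.plays z, Γ.payoff θ s ≤ c) : Γ.value θ z ≤ c :=
  have : Nonempty (Γ.plays z) := (Γ.plays_nonempty z).to_subtype
  ciSup_le fun s => h s s.2

theorem drop_mem_plays (Γ : DynProg Z) {z : Z} {s : ℕ → Z} (hs : s ∈ Γ.plays z) (m : ℕ) :
    (fun t => s (m + t)) ∈ Γ.plays (s m) :=
  ⟨rfl, fun t => hs.2 (m + t)⟩

theorem bddAbove_range_value_shift (Γ : DynProg Z) (θ : Evaluation) (z : Z) :
    BddAbove (Set.range fun m : ℕ => Γ.value (Evaluation.shift θ m) z) :=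
  ⟨1, by rintro _ ⟨m, rfl⟩; exact (Γ.value_mem _ z).2⟩

theorem valueStar_le (Γ : DynProg Z) (θ : Evaluation) (z : Z) :
    Γ.valueStar z ≤ ⨆ m : ℕ, Γ.value (Evaluation.shift θ m) z :=
  ciInf_le ⟨0, by rintro _ ⟨η, rfl⟩; exact Real.iSup_nonneg fun m => (Γ.value_mem _ z).1⟩ θ

/-- Averaging the `θ`-payoffs of the shifts of a play for `η` is the same as averaging its
`η`-payoffs for `θ`: both are its payoff for the convolution of `θ` and `η`. -/
theorem tsum_weight_mul_payoff_comm (Γ : DynProg Z) (θ η : Evaluation) (s : ℕ → Z) :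
    ∑' u : ℕ+, Evaluation.weight η u * Γ.payoff θ (fun t => s (u + t)) =
      ∑' t : ℕ+, Evaluation.weight θ t * Γ.payoff η (fun u => s (t + u)) := by
  have hsum : Summable (Function.uncurry fun u t : ℕ+ =>
      Evaluation.weight η u * (Evaluation.weight θ t * (Γ.r (s (u + t)) : ℝ))) := by
    refine Summable.of_nonneg_of_le (fun p => ?_) (fun p => ?_)
      ((Evaluation.hasSum_weight η).summable.mul_of_nonneg (Evaluation.hasSum_weight θ).summable
        (Evaluation.weight_nonneg η) (Evaluation.weight_nonneg θ))
    · exact mul_nonneg (Evaluation.weight_nonneg η _)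
        (mul_nonneg (Evaluation.weight_nonneg θ _) (Γ.r _).2.1)
    · exact mul_le_mul_of_nonneg_left
        (mul_le_of_le_one_right (Evaluation.weight_nonneg θ _) (Γ.r _).2.2)
        (Evaluation.weight_nonneg η _)
  unfold payoff
  simp only [← tsum_mul_left]
  refine hsum.tsum_comm.symm.trans ?_
  refine tsum_congr fun t => tsum_congr fun u => ?_
  rw [add_comm (t : ℕ) (u : ℕ)]
  ring

/-! ### Bounding values by the supremum of shifted values -/

theorem value_le_iSup_add (Γ : DynProg Z) (θ η : Evaluation) (z : Z) :
    Γ.value θ z ≤ (⨆ m : ℕ, Γ.value (Evaluation.shift η m) z) +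
      Evaluation.smoothingError η (Evaluation.TV θ) := by
  refine Γ.value_le θ fun s hs => ?_
  have hTV := Evaluation.TV_nonneg θ
  have hp := fun u : ℕ+ => Γ.payoff_mem θ fun t => s (u + t)
  have hm0 : ∀ u : ℕ+, 0 ≤ min 1 (2 * ((u : ℕ) : ℝ) * Evaluation.TV θ) := fun u =>
    le_min zero_le_one (by positivity)
  have hsum1 := Evaluation.summable_weight_mul η (fun u => (hp u).1) fun u => (hp u).2
  have hsum2 := Evaluation.summable_weight_mul η hm0 fun u => min_le_left _ _
  have hconst := (Evaluation.hasSum_weight η).mul_right (Γ.payoff θ s)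
  rw [one_mul] at hconst
  -- The payoff of `s` is the `η`-average of itself, and each copy is shifted by `u` stages.
  have hle : Γ.payoff θ s ≤ ∑' u : ℕ+, Evaluation.weight η u * Γ.payoff θ (fun t => s (u + t)) +
      Evaluation.smoothingError η (Evaluation.TV θ) := by
    unfold Evaluation.smoothingError
    rw [← hsum1.tsum_add hsum2]
    refine hconst.tsum_eq.symm.trans_le (hconst.summable.tsum_le_tsum (fun u => ?_)
      (hsum1.add hsum2))
    rw [← mul_add]
    refine mul_le_mul_of_nonneg_left ?_ (Evaluation.weight_nonneg η u)
    rw [← sub_le_iff_le_add']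
    refine le_min ?_ ?_
    · linarith [(Γ.payoff_mem θ s).2, (hp u).1]
    · linarith [Γ.payoff_le_payoff_drop_add θ s u]
  refine hle.trans (add_le_add_left ?_ _)
  -- Read as a `θ`-average, the sum only involves payoffs for `η ⊕ t`.
  rw [Γ.tsum_weight_mul_payoff_comm]
  refine Evaluation.tsum_weight_mul_le θ (fun t => (Γ.payoff_mem _ _).1)
    (fun t => (Γ.payoff_mem _ _).2) fun t => ?_
  rw [← Γ.payoff_shift]
  exact (Γ.payoff_le_value _ hs).trans (le_ciSup (Γ.bddAbove_range_value_shift η z) (t : ℕ))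

/-- Going to `y` first and then following a play at `y` is a play at `z`. -/
theorem value_le_value_add_of_mem (Γ : DynProg Z) (θ : Evaluation) {z y : Z} (hy : y ∈ Γ.F z) :
    Γ.value θ y ≤ Γ.value θ z + 2 * Evaluation.TV θ := by
  refine Γ.value_le θ fun s hs => ?_
  let s' : ℕ → Z := fun t => Nat.casesOn t z s
  have hs' : s' ∈ Γ.plays z := by
    refine ⟨rfl, fun t => ?_⟩
    cases t with
    | zero => exact (congrArg (· ∈ Γ.F z) hs.1).mpr hy
    | succ t => exact hs.2 t
  have h := (abs_le.1 (Γ.abs_payoff_drop_one_sub_le θ s')).2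
  have h' := Γ.payoff_le_value θ hs'
  have e : (fun t => s' (t + 1)) = s := rfl
  rw [e] at h
  linarith

/-! ### Limits of values along a filter -/

section Limits

variable {ι : Type*} {l : Filter ι} {θ : ι → Evaluation}

theorem le_valueStar_of_tendsto (Γ : DynProg Z) [l.NeBot]
    (hTV : Tendsto (fun i => Evaluation.TV (θ i)) l (𝓝 0)) {z : Z} {c : ℝ}
    (hc : Tendsto (fun i => Γ.value (θ i) z) l (𝓝 c)) : c ≤ Γ.valueStar z := by
  have : Nonempty Evaluation := ⟨PMF.pure 1⟩
  refine le_ciInf fun η => ?_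
  have h := (Evaluation.tendsto_smoothingError η
    (fun i => Evaluation.TV_nonneg (θ i)) hTV).const_add (⨆ m : ℕ, Γ.value (Evaluation.shift η m) z)
  rw [add_zero] at h
  exact le_of_tendsto_of_tendsto' hc h fun i => Γ.value_le_iSup_add (θ i) η z

/-- A pointwise limit of values whose total variation vanishes does not increase along plays. -/
theorem limit_play_le (Γ : DynProg Z) [l.NeBot] {w : Z → ℝ}
    (hTV : Tendsto (fun i => Evaluation.TV (θ i)) l (𝓝 0))
    (hw : ∀ z, Tendsto (fun i => Γ.value (θ i) z) l (𝓝 (w z))) {z : Z} {s : ℕ → Z}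
    (hs : s ∈ Γ.plays z) (m : ℕ) : w (s m) ≤ w z := by
  induction m with
  | zero => rw [hs.1]
  | succ m ih =>
    refine le_trans ?_ ih
    have h := (hw (s m)).add (hTV.const_mul 2)
    rw [mul_zero, add_zero] at h
    exact le_of_tendsto_of_tendsto' (hw _) h fun i =>
      Γ.value_le_value_add_of_mem (θ i) (hs.2 m)

theorem valueStar_le_of_tendstoUniformly (Γ : DynProg Z) [l.NeBot] {w : Z → ℝ}
    (hTV : Tendsto (fun i => Evaluation.TV (θ i)) l (𝓝 0))
    (hw : TendstoUniformly (fun i => Γ.value (θ i)) w l) (z : Z) : Γ.valueStar z ≤ w z := by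
  refine le_of_forall_pos_le_add fun ε hε => ?_
  obtain ⟨i, hi⟩ := (Metric.tendstoUniformly_iff.1 hw ε hε).exists
  refine (Γ.valueStar_le (θ i) z).trans (ciSup_le fun m => Γ.value_le _ fun s hs => ?_)
  rw [Γ.payoff_shift]
  have h1 := Γ.payoff_le_value (θ i) (Γ.drop_mem_plays hs m)
  have h2 := Γ.limit_play_le hTV (fun y => hw.tendsto_at y) hs m
  have h3 := hi (s m)
  rw [Real.dist_eq, abs_lt] at h3
  linarith [h3.1]

theorem tendsto_valueFun_iff (Γ : DynProg Z) {w : Z →ᵤ unitInterval} :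
    Tendsto (fun i => Γ.valueFun (θ i)) l (𝓝 w) ↔
      TendstoUniformly (fun i => Γ.value (θ i))
        (fun z => ((UniformFun.toFun w z : unitInterval) : ℝ)) l := by
  rw [UniformFun.tendsto_iff_tendstoUniformly, Metric.tendstoUniformly_iff,
    Metric.tendstoUniformly_iff]
  rfl

theorem eq_valueStarFun_of_tendsto (Γ : DynProg Z) [l.NeBot]
    (hTV : Tendsto (fun i => Evaluation.TV (θ i)) l (𝓝 0)) {w : Z →ᵤ unitInterval}
    (hw : Tendsto (fun i => Γ.valueFun (θ i)) l (𝓝 w)) : w = Γ.valueStarFun := by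
  rw [tendsto_valueFun_iff] at hw
  apply UniformFun.toFun.injective
  funext z
  exact Subtype.ext (le_antisymm (Γ.le_valueStar_of_tendsto hTV (hw.tendsto_at z))
    (Γ.valueStar_le_of_tendstoUniformly hTV hw z))

end Limits

theorem tendsto_valueStarFun_of_cauchy (Γ : DynProg Z) {ι : Type*} {l : Filter ι}
    {θ : ι → Evaluation} (hTV : Tendsto (fun i => Evaluation.TV (θ i)) l (𝓝 0))
    (hC : ∀ U : Ultrafilter ι, (U : Filter ι) ≤ l →
      Cauchy (map (fun i => Γ.valueFun (θ i)) (U : Filter ι))) :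
    Tendsto (fun i => Γ.valueFun (θ i)) l (𝓝 Γ.valueStarFun) := by
  rw [tendsto_iff_ultrafilter]
  intro U hU
  obtain ⟨w, hw⟩ := CompleteSpace.complete (hC U hU)
  rwa [← Γ.eq_valueStarFun_of_tendsto (hTV.mono_left hU) hw]

theorem tendsto_valueStarFun_of_totallyBounded (Γ : DynProg Z) {ι : Type*} {l : Filter ι}
    {θ : ι → Evaluation} (hTV : Tendsto (fun i => Evaluation.TV (θ i)) l (𝓝 0))
    (hT : TotallyBounded (Set.range fun i => Γ.valueFun (θ i))) :
    Tendsto (fun i => Γ.valueFun (θ i)) l (𝓝 Γ.valueStarFun) := by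
  refine Γ.tendsto_valueStarFun_of_cauchy hTV fun U _ => ?_
  exact totallyBounded_iff_ultrafilter.1 hT (U.map _)
    (le_principal_iff.2 (mem_map.2 (univ_mem' fun i => ⟨i, rfl⟩)))

/-! ### Equicontinuous values -/

/-- The Arzelà–Ascoli argument, for a state space that need not be complete: along an
ultrafilter the values converge at the points of a finite net, and equicontinuity controls the
remaining points. -/
theorem cauchy_map_valueFun [MetricSpace Z] (Γ : DynProg Z)
    (hZ : TotallyBounded (Set.univ : Set Z))
    (hE : UniformEquicontinuous (fun θ : Evaluation => Γ.value θ)) (U : Ultrafilter Evaluation) :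
    Cauchy (map Γ.valueFun (U : Filter Evaluation)) := by
  have hlim : ∀ z, ∃ c, Tendsto (fun θ => Γ.value θ z) U (𝓝 c) := fun z => by
    obtain ⟨c, -, hc⟩ := (isCompact_Icc (a := (0 : ℝ)) (b := 1)).ultrafilter_le_nhds
      (U.map fun θ => Γ.value θ z)
      (le_principal_iff.2 (mem_map.2 (univ_mem' fun θ => Γ.value_mem θ z)))
    exact ⟨c, hc⟩
  choose w hw using hlim
  have h01 : ∀ z, w z ∈ unitInterval := fun z =>
    isClosed_Icc.mem_of_tendsto (hw z) (Eventually.of_forall fun θ => Γ.value_mem θ z)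
  have hT : Tendsto (fun θ => Γ.valueFun θ) U
      (𝓝 (UniformFun.ofFun fun z => (⟨w z, h01 z⟩ : unitInterval))) := by
    rw [tendsto_valueFun_iff (θ := fun θ => θ), Metric.tendstoUniformly_iff]
    intro ε hε
    change ∀ᶠ θ in (U : Filter Evaluation), ∀ z, dist (w z) (Γ.value θ z) < ε
    obtain ⟨δ, hδ, hδε⟩ := Metric.uniformEquicontinuous_iff.1 hE (ε / 4) (by positivity)
    obtain ⟨t, -, ht, hcover⟩ := Metric.finite_approx_of_totallyBounded hZ δ hδ
    have hev : ∀ᶠ θ in (U : Filter Evaluation), ∀ y ∈ t, dist (Γ.value θ y) (w y) < ε / 4 :=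
      (eventually_all_finite ht).2 fun y _ => Metric.tendsto_nhds.1 (hw y) _ (by positivity)
    filter_upwards [hev] with θ hθ z
    obtain ⟨y, hy, hzy⟩ := Set.mem_iUnion₂.1 (hcover (Set.mem_univ z))
    have h1 : dist (w z) (w y) ≤ ε / 4 :=
      le_of_tendsto ((hw z).dist (hw y)) (Eventually.of_forall fun η => (hδε z y hzy η).le)
    have h2 := hθ y hy
    have h3 := hδε z y hzy θ
    have h4 := dist_triangle4 (w z) (w y) (Γ.value θ y) (Γ.value θ z)
    rw [dist_comm] at h2 h3
    linarith
  exact hT.cauchy_map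

theorem generalUniformConvergence_of_uniformEquicontinuous [MetricSpace Z] (Γ : DynProg Z)
    (hZ : TotallyBounded (Set.univ : Set Z))
    (hE : UniformEquicontinuous (fun θ : Evaluation => Γ.value θ)) :
    Γ.GeneralUniformConvergence := by
  have hT := Γ.tendsto_valueStarFun_of_cauchy (θ := fun θ => θ)
    (l := comap Evaluation.TV (𝓝 0)) tendsto_comap fun U _ => Γ.cauchy_map_valueFun hZ hE U
  rw [tendsto_valueFun_iff, Metric.tendstoUniformly_iff] at hT
  intro ε hε
  obtain ⟨α, hα, h⟩ := ((Metric.nhds_basis_closedBall (x := (0 : ℝ))).comap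
    Evaluation.TV).eventually_iff.1 (hT ε hε)
  refine ⟨α, hα, fun θ hθ z => ?_⟩
  have hmem : θ ∈ Evaluation.TV ⁻¹' Metric.closedBall 0 α := by
    rw [Set.mem_preimage, mem_closedBall_zero_iff, Real.norm_eq_abs,
      abs_of_nonneg (Evaluation.TV_nonneg θ)]
    exact hθ
  have hz := (h hmem z).le
  rw [dist_comm] at hz
  exact hz

/-! ### Non expansive transitions -/

theorem NonExpansive.exists_play_dist_le [MetricSpace Z] {Γ : DynProg Z} (hF : Γ.NonExpansive)
    (z' : Z) {z : Z} {s : ℕ → Z} (hs : s ∈ Γ.plays z) :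
    ∃ s' ∈ Γ.plays z', ∀ t, dist (s t) (s' t) ≤ dist z z' := by
  choose f hfF hfd using hF
  -- The new play, each state `y` at stage `t` being followed by an answer to `s (t + 1)`.
  let s' : ℕ → Z := fun t => Nat.rec z' (fun t y => f (s t) y (s (t + 1)) (hs.2 t)) t
  refine ⟨s', ⟨rfl, fun t => hfF _ _ _ _⟩, fun t => ?_⟩
  induction t with
  | zero => exact (congrArg (dist · z') hs.1).le
  | succ t ih => exact (hfd (s t) (s' t) (s (t + 1)) (hs.2 t)).trans ih

theorem payoff_le_payoff_add (Γ : DynProg Z) (θ : Evaluation) {s s' : ℕ → Z} {ε : ℝ}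
    (h : ∀ t, (Γ.r (s t) : ℝ) ≤ Γ.r (s' t) + ε) : Γ.payoff θ s ≤ Γ.payoff θ s' + ε := by
  have hε := (Evaluation.hasSum_weight θ).mul_right ε
  rw [one_mul] at hε
  have hs' := Γ.summable_payoff θ s'
  unfold payoff
  rw [← hε.tsum_eq, ← hs'.tsum_add hε.summable]
  refine (Γ.summable_payoff θ s).tsum_le_tsum (fun t => ?_) (hs'.add hε.summable)
  rw [← mul_add]
  exact mul_le_mul_of_nonneg_left (h t) (Evaluation.weight_nonneg θ t)

theorem NonExpansive.uniformEquicontinuous_value [MetricSpace Z] {Γ : DynProg Z}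
    (hF : Γ.NonExpansive) (hr : UniformContinuous Γ.r) :
    UniformEquicontinuous (fun θ : Evaluation => Γ.value θ) := by
  rw [Metric.uniformEquicontinuous_iff]
  intro ε hε
  obtain ⟨δ, hδ, h⟩ := Metric.uniformContinuous_iff.1 hr (ε / 2) (by positivity)
  have key : ∀ z z' : Z, dist z z' < δ → ∀ θ, Γ.value θ z ≤ Γ.value θ z' + ε / 2 := by
    intro z z' hz θ
    refine Γ.value_le θ fun s hs => ?_
    obtain ⟨s', hs', hd⟩ := hF.exists_play_dist_le z' hs
    refine (Γ.payoff_le_payoff_add θ fun t => ?_).trans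
      (add_le_add_left (Γ.payoff_le_value θ hs') _)
    have ht : |(Γ.r (s t) : ℝ) - Γ.r (s' t)| < ε / 2 := h ((hd t).trans_lt hz)
    linarith [(abs_lt.1 ht).2]
  refine ⟨δ, hδ, fun z z' hz θ => ?_⟩
  have h1 := key z z' hz θ
  have h2 := key z' z (by rwa [dist_comm]) θ
  rw [Real.dist_eq, abs_lt]
  constructor <;> linarith

end DynProg

theorem mainTheorem8 {Z : Type*} [Nonempty Z] (Γ : DynProg Z) :
    (∀ θ : ℕ → Evaluation, Tendsto (fun k => Evaluation.TV (θ k)) atTop (𝓝 0) →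
      -- 1)
      (∀ w : Z →ᵤ unitInterval,
        Tendsto (fun k => Γ.valueFun (θ k)) atTop (𝓝 w) → w = Γ.valueStarFun) ∧
      -- 2)
      ((∃ w : Z →ᵤ unitInterval, Tendsto (fun k => Γ.valueFun (θ k)) atTop (𝓝 w)) ↔
        TotallyBounded (Set.range fun k => Γ.valueFun (θ k))) ∧
      ((∃ w : Z →ᵤ unitInterval, Tendsto (fun k => Γ.valueFun (θ k)) atTop (𝓝 w)) ↔
        IsCompact ((Set.range fun k => Γ.valueFun (θ k)) ∪ {Γ.valueStarFun}))) ∧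
    -- 3)
    (∀ [MetricSpace Z], TotallyBounded (Set.univ : Set Z) →
      UniformEquicontinuous (fun θ : Evaluation => Γ.value θ) →
      Γ.GeneralUniformConvergence) ∧
    -- 4)
    (∀ [MetricSpace Z], TotallyBounded (Set.univ : Set Z) →
      UniformContinuous Γ.r → Γ.NonExpansive →
      Γ.GeneralUniformConvergence) := by
  refine ⟨fun θ hTV => ?_, fun hZ hE =>
    Γ.generalUniformConvergence_of_uniformEquicontinuous hZ hE, fun hZ hr hF =>
    Γ.generalUniformConvergence_of_uniformEquicontinuous hZ (hF.uniformEquicontinuous_value hr)⟩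
  have hlim : ∀ w : Z →ᵤ unitInterval,
      Tendsto (fun k => Γ.valueFun (θ k)) atTop (𝓝 w) → w = Γ.valueStarFun :=
    fun w hw => Γ.eq_valueStarFun_of_tendsto hTV hw
  have hcompact : (∃ w : Z →ᵤ unitInterval,
      Tendsto (fun k => Γ.valueFun (θ k)) atTop (𝓝 w)) →
      IsCompact ((Set.range fun k => Γ.valueFun (θ k)) ∪ {Γ.valueStarFun}) := by
    rintro ⟨w, hw⟩
    rw [Set.union_singleton, ← hlim w hw]
    exact hw.isCompact_insert_range
  have hconv : TotallyBounded (Set.range fun k => Γ.valueFun (θ k)) →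
      ∃ w : Z →ᵤ unitInterval, Tendsto (fun k => Γ.valueFun (θ k)) atTop (𝓝 w) :=
    fun hT => ⟨_, Γ.tendsto_valueStarFun_of_totallyBounded hTV hT⟩
  have htb : IsCompact ((Set.range fun k => Γ.valueFun (θ k)) ∪ {Γ.valueStarFun}) →
      TotallyBounded (Set.range fun k => Γ.valueFun (θ k)) :=
    fun hK => hK.totallyBounded.subset Set.subset_union_left
  exact ⟨hlim, ⟨fun h => htb (hcompact h), hconv⟩, hcompact, fun h => hconv (htb h)⟩
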